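/- Let $M$ be a smooth manifold of dimension $m+1$ with a smooth Riemannian metric $a=\langle\cdot,\cdot\rangle$ and a smooth 1-form $\beta$ with $\|\beta\|_\alpha<1$, where $\|\beta\|_\alpha=\langle\beta^\sharp,\beta^\sharp\rangle^{1/2}$ and $\langle\beta^\sharp,u\rangle=\beta(u)$. Let $F(y)=\sqrt{\langle y,y\rangle}+\beta(y)$ be the Randers metric and, for $y\neq0$, $g_y(u,v)=\frac12\frac{\partial^2}{\partial s\,\partial t}F^2(y+su+tv)|_{s=t=0}$. Let $\mathcal F$ be a transversally oriented smooth codimension-one foliation of $M$ with smooth unit $a$-normal field $N$, and assume $\beta(N)=0$ on $M$. Let $n$ be the vector field with $\langle n,n\rangle=1$, $\langle n,N\rangle>0$ and $g_n(n,w)=0$ for all $w\in T\mathcal F$. Put $g=g_n$, $\nu=n/F(n)$ and $c=(1-\|\beta\|_\alpha^2)^{1/2}$, and let $\bar\nabla$, $\nabla$ be the Levi-Civita connections of $a$ and $g$. For $u\in T\mathcal F$ put $\bar A(u)=-\bar\nabla_uN$ and $A^g(u)=-\nabla_u\nu$; further let $\bar Z=\bar\nabla_NN$, $2\,\overline{\rm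 Def}_{\xi}=\bar\nabla\xi+(\bar\nabla\xi)^t$ (where $(\bar\nabla \xi)(v)=\bar\nabla_v\xi$ and ${}^t$ is the $a$-conjugate), let ${}^\top$ be the $a$-orthogonal projection to $T\mathcal F$, $v^\flat=\langle v,\cdot\rangle$, $(\omega\otimes X)(u)=(X\otimes\omega)(u)=\omega(u)X$ for a 1-form $\omega$ and a vector $X$, and $\bar A(\beta^\sharp)^{\bot\beta}=\bar A(\beta^\sharp)-\langle\bar A(\beta^\sharp),\beta^\sharp\rangle\,\|\beta\|_\alpha^{-2}\,\beta^\sharp$ (which is $0$ where $\beta=0$). Then on $T\mathcal F$ $$c\,A^g=\bar A-c^{-2}(cN-\beta^\sharp)(c)\,{\rm id}+c^{-1}(\overline{\rm Def}_{\beta^\sharp})^\top_{|T\mathcal F}+U_1^\flat\otimes\beta^\sharp+U_2\otimes\beta,$$ where $$U_1=-\tfrac12c^{-2}\big((cN-\beta^\sharp)(c)\,\beta^\sharp-2c^{-1}(\overline{\rm Def}_{\beta^\sharp}\beta^\sharp)^\top-(\bar\nabla_{N-c^{-1}\beta^\sharp}\beta^\sharp)^\top+c\bar Z+c\,\beta(\bar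 Z)\beta^\sharp-\bar A(\beta^\sharp)^{\bot\beta}\big),$$ $$U_2=\tfrac12\big((\bar\nabla_{N-c^{-1}\beta^\sharp}\beta^\sharp)^\top-c\bar Z-\bar A(\beta^\sharp)^{\bot\beta}\big).$$ Moreover, if $\|\beta\|_\alpha$ is constant, then on $T\mathcal F$ $$c\,A^g=\bar A+c^{-1}(\overline{\rm Def}_{\beta^\sharp})^\top_{|T\mathcal F}+\tfrac12\big((\bar\nabla_{N-c^{-1}\beta^\sharp}\beta^\sharp)^\top-c\bar Z-\bar A(\beta^\sharp)^{\bot\beta}\big)\otimes\beta$$ $$\qquad+\tfrac12c^{-2}\big(2c^{-1}(\overline{\rm Def}_{\beta^\sharp}\beta^\sharp)^\top+(\bar\nabla_{N-c^{-1}\beta^\sharp}\beta^\sharp)^\top+\bar A(\beta^\sharp)^{\bot\beta}-c\bar Z-c\langle\bar Z,\beta^\sharp\rangle\beta^\sharp\big)^\flat\otimes\beta^\sharp;$$ and if $\bar\nabla\beta=0$ (the Berwald case), then on $T\mathcal F$ $$c\,A^g=\bar A-\tfrac12\big(\bar A(\beta^\sharp)^{\bot\beta}+c\bar Z\big)\otimes\beta+\tfrac12c^{-2}\big(\bar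 A(\beta^\sharp)^{\bot\beta}-c\bar Z-c\langle\bar Z,\beta^\sharp\rangle\beta^\sharp\big)^\flat\otimes\beta^\sharp.$$ -/

import Mathlib

open Bundle
open scoped Manifold ContDiff

namespace RandersFoliation

noncomputable section

/-- The model space of a manifold of dimension `m + 1`. -/
abbrev Model (m : ℕ) : Type := EuclideanSpace ℝ (Fin (m + 1))

section LinearAlgebra

/-- The symmetric bilinear form
`g_y(u, v) = 1/2 ∂²/∂s∂t F²(y + s u + t v)` at `s = t = 0` of a Minkowski norm `F`. -/
def fundamentalForm {V : Type*} [AddCommGroup V] [Module ℝ V] (F : V → ℝ) (y u v : V) : ℝ :=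
  (1 / 2) * deriv (fun s : ℝ => deriv (fun t : ℝ => F (y + s • u + t • v) ^ 2) 0) 0

end LinearAlgebra

section Manifold

variable (m : ℕ) (M : Type*) [TopologicalSpace M] [ChartedSpace (Model m) M]

/-- Vector fields on `M` (no regularity is built in). -/
abbrev VField : Type _ := ∀ p : M, TangentSpace (𝓡 (m + 1)) p

/-- One-forms on `M` (no regularity is built in). -/
abbrev OneForm : Type _ := ∀ p : M, TangentSpace (𝓡 (m + 1)) p →L[ℝ] ℝ

/-- A codimension-one smooth foliation of `M`, recorded by the tangent spaces of its leaves: it is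
given near each point by the level sets of a smooth submersion to `ℝ`. -/
structure CodimOneFoliation where
  /-- the tangent space at `p` of the leaf through `p` -/
  tangent : ∀ p : M, Submodule ℝ (TangentSpace (𝓡 (m + 1)) p)
  locally_level_sets : ∀ p : M, ∃ (U : Set M) (f : M → ℝ), IsOpen U ∧ p ∈ U ∧
    ContMDiffOn (𝓡 (m + 1)) 𝓘(ℝ, ℝ) ∞ f U ∧
    ∀ q ∈ U, mvfderiv (𝓡 (m + 1)) f q ≠ 0 ∧
      ∀ v : TangentSpace (𝓡 (m + 1)) q, v ∈ tangent q ↔ mvfderiv (𝓡 (m + 1)) f q v = 0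

variable [IsManifold (𝓡 (m + 1)) ∞ M]

/-- Smooth Riemannian metrics on `M`. -/
abbrev Metric : Type _ :=
  ContMDiffRiemannianMetric (𝓡 (m + 1)) ∞ (Model m)
    (fun p : M => TangentSpace (𝓡 (m + 1)) p)

/-- Affine connections on `M`; `D Y p v` is `(D_v Y)(p)`. -/
abbrev Connection : Type _ :=
  CovariantDerivative (𝓡 (m + 1)) (Model m) (TangentSpace (𝓡 (m + 1)) : M → Type _)

variable {m M}

/-- The vector field `X` is smooth. -/
def SmoothField (X : VField m M) : Prop :=
  ContMDiff (𝓡 (m + 1)) ((𝓡 (m + 1)).prod 𝓘(ℝ, Model m)) ∞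
    (fun p => TotalSpace.mk' (Model m) p (X p))

/-- The one-form `β` is smooth. -/
def SmoothForm (β : OneForm m M) : Prop :=
  ContMDiff (𝓡 (m + 1)) ((𝓡 (m + 1)).prod 𝓘(ℝ, Model m →L[ℝ] ℝ)) ∞
    (fun p => TotalSpace.mk' (Model m →L[ℝ] ℝ)
      (E := fun p : M => TangentSpace (𝓡 (m + 1)) p →L[ℝ] ℝ) p (β p))

/-- `D` is the Levi-Civita connection of `g`: it is torsion free and
`v (g(Y, Z)) = g(D_v Y, Z) + g(Y, D_v Z)`. -/
def IsLeviCivita (g : ∀ p : M, TangentSpace (𝓡 (m + 1)) p → TangentSpace (𝓡 (m + 1)) p → ℝ)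
    (D : Connection m M) : Prop :=
  D.torsion = 0 ∧
    ∀ (Y Z : VField m M) (p : M),
      MDifferentiableAt (𝓡 (m + 1)) ((𝓡 (m + 1)).prod 𝓘(ℝ, Model m))
        (fun q => TotalSpace.mk' (Model m) q (Y q)) p →
      MDifferentiableAt (𝓡 (m + 1)) ((𝓡 (m + 1)).prod 𝓘(ℝ, Model m))
        (fun q => TotalSpace.mk' (Model m) q (Z q)) p →
      ∀ v : TangentSpace (𝓡 (m + 1)) p,
        mvfderiv (𝓡 (m + 1)) (fun q => g q (Y q) (Z q)) p v
          = g p (D Y p v) (Z p) + g p (Y p) (D Z p v)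

/-- `D β = 0`, where `(D_v β)(Y) = v (β(Y)) - β(D_v Y)`. -/
def IsParallelForm (D : Connection m M) (β : OneForm m M) : Prop :=
  ∀ (Y : VField m M) (p : M),
    MDifferentiableAt (𝓡 (m + 1)) ((𝓡 (m + 1)).prod 𝓘(ℝ, Model m))
      (fun q => TotalSpace.mk' (Model m) q (Y q)) p →
    ∀ v : TangentSpace (𝓡 (m + 1)) p,
      mvfderiv (𝓡 (m + 1)) (fun q => β q (Y q)) p v - β p (D Y p v) = 0

theorem exists_sharp (a : Metric m M) (p : M) (φ : TangentSpace (𝓡 (m + 1)) p →L[ℝ] ℝ) :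
    ∃ w : TangentSpace (𝓡 (m + 1)) p, ∀ u, a.inner p w u = φ u := by
  have : FiniteDimensional ℝ (TangentSpace (𝓡 (m + 1)) p) :=
    inferInstanceAs (FiniteDimensional ℝ (Model m))
  let L : TangentSpace (𝓡 (m + 1)) p →ₗ[ℝ] Module.Dual ℝ (TangentSpace (𝓡 (m + 1)) p) :=
    { toFun := fun w => (a.inner p w : TangentSpace (𝓡 (m + 1)) p →ₗ[ℝ] ℝ)
      map_add' := fun x y => by ext u; simp
      map_smul' := fun r x => by ext u; simp }
  have hinj : Function.Injective L := by
    rw [injective_iff_map_eq_zero]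
    intro w hw
    by_contra hne
    have h1 : a.inner p w w = 0 := by
      have := congrArg (fun f => f w) hw
      simpa [L] using this
    exact absurd h1 (a.pos p w hne).ne'
  have hsurj : Function.Surjective L :=
    (LinearMap.injective_iff_surjective_of_finrank_eq_finrank
      (Subspace.dual_finrank_eq (K := ℝ) (V := TangentSpace (𝓡 (m + 1)) p)).symm).1 hinj
  obtain ⟨w, hw⟩ := hsurj (φ : TangentSpace (𝓡 (m + 1)) p →ₗ[ℝ] ℝ)
  exact ⟨w, fun u => by simpa [L] using congrArg (fun f => f u) hw⟩

/-- The vector `φ♯` with `⟨φ♯, u⟩ = φ(u)` for all `u`. -/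
def sharp (a : Metric m M) (p : M) (φ : TangentSpace (𝓡 (m + 1)) p →L[ℝ] ℝ) :
    TangentSpace (𝓡 (m + 1)) p :=
  Classical.choose (exists_sharp a p φ)

theorem inner_sharp (a : Metric m M) (p : M) (φ : TangentSpace (𝓡 (m + 1)) p →L[ℝ] ℝ)
    (u : TangentSpace (𝓡 (m + 1)) p) : a.inner p (sharp a p φ) u = φ u :=
  Classical.choose_spec (exists_sharp a p φ) u

/-- The vector field `β♯`. -/
def sharpField (a : Metric m M) (β : OneForm m M) : VField m M := fun p => sharp a p (β p)

/-- The norm `‖β‖_α = ‖β♯‖_α` at `p`. -/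
def formNorm (a : Metric m M) (β : OneForm m M) (p : M) : ℝ :=
  Real.sqrt (a.inner p (sharpField a β p) (sharpField a β p))

/-- The function `c = (1 - ‖β‖_α²)^{1/2}`. -/
def cFun (a : Metric m M) (β : OneForm m M) (p : M) : ℝ :=
  Real.sqrt (1 - formNorm a β p ^ 2)

/-- The Randers norm `F(y) = √⟨y, y⟩ + β(y)` on `T_pM`. -/
def randersNorm (a : Metric m M) (β : OneForm m M) (p : M) (y : TangentSpace (𝓡 (m + 1)) p) : ℝ :=
  Real.sqrt (a.inner p y y) + β p y

/-- The bilinear form `g_{n(p)}` of the Randers norm on `T_pM`. -/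
def inducedMetric (a : Metric m M) (β : OneForm m M) (n : VField m M) (p : M)
    (u v : TangentSpace (𝓡 (m + 1)) p) : ℝ :=
  fundamentalForm (randersNorm a β p) (n p) u v

/-- `N` is a smooth unit normal field of the foliation for the metric `a`; such an `N` amounts to
a transversal orientation. -/
structure IsUnitNormal (a : Metric m M) (ℱ : CodimOneFoliation m M) (N : VField m M) : Prop where
  smooth : SmoothField N
  unit : ∀ p, a.inner p (N p) (N p) = 1
  normal : ∀ p, ∀ w ∈ ℱ.tangent p, a.inner p (N p) w = 0

/-- `n` is the `F`-normal field of the foliation with `⟨n, n⟩ = 1` which lies on the same side of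
the leaves as `N`. -/
structure IsFinslerNormal (a : Metric m M) (β : OneForm m M) (ℱ : CodimOneFoliation m M)
    (N n : VField m M) : Prop where
  unit : ∀ p, a.inner p (n p) (n p) = 1
  same_side : ∀ p, 0 < a.inner p (n p) (N p)
  normal : ∀ p, ∀ w ∈ ℱ.tangent p, fundamentalForm (randersNorm a β p) (n p) (n p) w = 0

/-- The `F`-unit normal `ν = n / F(n)`. -/
def finslerUnit (a : Metric m M) (β : OneForm m M) (n : VField m M) : VField m M :=
  fun p => (randersNorm a β p (n p))⁻¹ • n p

/-- The operator `u ↦ - D_u ξ`; it is the shape operator when `ξ` is a unit normal field and `D` the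
Levi-Civita connection of the metric. -/
def shape (D : Connection m M) (ξ : VField m M) (p : M) (u : TangentSpace (𝓡 (m + 1)) p) :
    TangentSpace (𝓡 (m + 1)) p :=
  - D ξ p u

/-- The component `X - ⟨X, N⟩ N` of `X` tangent to the leaf. -/
def tang (a : Metric m M) (N : VField m M) (p : M) (X : TangentSpace (𝓡 (m + 1)) p) :
    TangentSpace (𝓡 (m + 1)) p :=
  X - a.inner p X (N p) • N p

/-- The conjugate `(D ξ)^t` of the endomorphism `D ξ` with respect to `a`:
`⟨(D ξ)^t v, w⟩ = ⟨v, D_w ξ⟩`. -/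
def conjDeriv (a : Metric m M) (D : Connection m M) (ξ : VField m M) (p : M)
    (v : TangentSpace (𝓡 (m + 1)) p) : TangentSpace (𝓡 (m + 1)) p :=
  sharp a p ((a.inner p v).comp (D ξ p))

/-- The deformation tensor `Def_ξ = (D ξ + (D ξ)^t) / 2`. -/
def deform (a : Metric m M) (D : Connection m M) (ξ : VField m M) (p : M)
    (v : TangentSpace (𝓡 (m + 1)) p) : TangentSpace (𝓡 (m + 1)) p :=
  (1 / 2 : ℝ) • (D ξ p v + conjDeriv a D ξ p v)

/-- `X^{⊥β} = X - ⟨X, β♯⟩ ‖β♯‖⁻² β♯`; by the convention `0⁻¹ = 0` this is `X` where `β = 0`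
(it is only used for an `X` that vanishes there). -/
def perpForm (a : Metric m M) (β : OneForm m M) (p : M) (X : TangentSpace (𝓡 (m + 1)) p) :
    TangentSpace (𝓡 (m + 1)) p :=
  X - (a.inner p X (sharpField a β p) * (formNorm a β p ^ 2)⁻¹) • sharpField a β p

/-- The curvature vector `Z̄ = D_N N`. -/
def curvVec (D : Connection m M) (N : VField m M) (p : M) : TangentSpace (𝓡 (m + 1)) p :=
  D N p (N p)

/-- The derivative `(c N - β♯)(c)` of the function `c`. -/
def derivC (a : Metric m M) (β : OneForm m M) (N : VField m M) (p : M) : ℝ :=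
  mvfderiv (𝓡 (m + 1)) (cFun a β) p (cFun a β p • N p - sharpField a β p)

/-- The vector `(D_{N - c⁻¹ β♯} β♯)^⊤`. -/
def transDeriv (a : Metric m M) (D : Connection m M) (β : OneForm m M) (N : VField m M) (p : M) :
    TangentSpace (𝓡 (m + 1)) p :=
  tang a N p (D (sharpField a β) p (N p - (cFun a β p)⁻¹ • sharpField a β p))

/-- The vector field `U₁`, where `D` is the Levi-Civita connection of `a`. -/
def U₁ (a : Metric m M) (D : Connection m M) (β : OneForm m M) (N : VField m M) (p : M) :
    TangentSpace (𝓡 (m + 1)) p :=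
  (-(1 / 2 : ℝ) * (cFun a β p ^ 2)⁻¹) •
    (derivC a β N p • sharpField a β p
      - (2 * (cFun a β p)⁻¹) • tang a N p (deform a D (sharpField a β) p (sharpField a β p))
      - transDeriv a D β N p
      + cFun a β p • curvVec D N p
      + (cFun a β p * β p (curvVec D N p)) • sharpField a β p
      - perpForm a β p (shape D N p (sharpField a β p)))

/-- The vector field `U₂`, where `D` is the Levi-Civita connection of `a`. -/
def U₂ (a : Metric m M) (D : Connection m M) (β : OneForm m M) (N : VField m M) (p : M) :
    TangentSpace (𝓡 (m + 1)) p :=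
  (1 / 2 : ℝ) •
    (transDeriv a D β N p - cFun a β p • curvVec D N p
      - perpForm a β p (shape D N p (sharpField a β p)))

end Manifold

end

end RandersFoliation

open RandersFoliation

/-! Write W = ∇_u ν with u tangent to a leaf. Orthogonality g_n(n, w) = (1 + β(n)) (⟨n, w⟩ + β(w)) =
0 on the leaves makes n + β♯ proportional to N, and normalization gives n = c N - β♯, F(n) = c² and
ν = c⁻² n (`IsFinslerNormal.eq_smul_sub`, `finslerUnit_eq`). Hence g(ν, ·) = c ⟨N, ·⟩, so both
metrics have the same normality condition on vectors tangent to a leaf, while on the leaves g = c²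
(a - β ⊗ β).

Leaf fields are closed under brackets, so for X, Y tangent to the leaves 2 g(∇_X ν, Y) is the Lie
derivative of g along ν (`two_mul_inner_deriv_unitNormal`). Brackets with ν can be computed with the
connection of a, which turns this into an explicit expression in the derivatives of N, β♯ and c
(`second_fundamental_form`).

This determines ⟨v, W⟩ - β(W) β(v) for each tangent v. The choice v = β♯, tangent because β(N) = 0,
gives c² β(W); eliminating β(W) leaves ⟨v, W⟩ (`shape_formula_aux`). Since g(ν, ν) = 1, W has no
N-component, so it is fully determined. The special cases follow by dropping the terms that vanish.
-/

/-! ### Lie brackets along level sets. -/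

open VectorField Topology in
/-- The Lie bracket of two vector fields annihilating a smooth function near `p` annihilates it
at `p`. -/
theorem mvfderiv_mlieBracket_eq_zero {E : Type*} [NormedAddCommGroup E] [NormedSpace ℝ E]
    [CompleteSpace E] {H : Type*} [TopologicalSpace H] {I : ModelWithCorners ℝ E H}
    [I.Boundaryless]
    {M : Type*} [TopologicalSpace M] [ChartedSpace H M] [IsManifold I 2 M]
    {f : M → ℝ} {X Y : ∀ p : M, TangentSpace I p} {p : M}
    (hf : ∀ᶠ q in 𝓝 p, ContMDiffAt I 𝓘(ℝ, ℝ) 2 f q)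
    (hX : MDifferentiableAt I (I.prod 𝓘(ℝ, E)) (fun q => TotalSpace.mk' E q (X q)) p)
    (hY : MDifferentiableAt I (I.prod 𝓘(ℝ, E)) (fun q => TotalSpace.mk' E q (Y q)) p)
    (hfX : ∀ᶠ q in 𝓝 p, mvfderiv I f q (X q) = 0)
    (hfY : ∀ᶠ q in 𝓝 p, mvfderiv I f q (Y q) = 0) :
    mvfderiv I f p (mlieBracket I X Y p) = 0 := by
  have hr : Set.range I = Set.univ := I.range_eq_univ
  have hps := mem_extChartAt_source (I := I) p
  have hpt := mem_extChartAt_target (I := I) p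
  have hfp : ContMDiffAt I 𝓘(ℝ, ℝ) 2 f p := hf.self_of_nhds
  have hback : (extChartAt I p).symm (extChartAt I p p) = p := extChartAt_to_inv p
  have hsymm : ContMDiffAt 𝓘(ℝ, E) I 2 (extChartAt I p).symm (extChartAt I p p) := by
    have := contMDiffWithinAt_extChartAt_symm_range (n := 2) (I := I) p hpt
    rwa [hr, contMDiffWithinAt_univ] at this
  have hcont : Filter.Tendsto (extChartAt I p).symm (𝓝 (extChartAt I p p)) (𝓝 p) := by
    have := hsymm.continuousAt.tendsto
    rwa [hback] at this
  have hf' : ContDiffAt ℝ 2 (f ∘ (extChartAt I p).symm) (extChartAt I p p) := by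
    rw [← contMDiffAt_iff_contDiffAt]
    exact ContMDiffAt.comp_of_eq hfp hsymm hback
  have hdiff : ∀ V : ∀ p : M, TangentSpace I p,
      MDifferentiableAt I (I.prod 𝓘(ℝ, E)) (fun q => TotalSpace.mk' E q (V q)) p →
      DifferentiableAt ℝ (mpullbackWithin 𝓘(ℝ, E) I (extChartAt I p).symm V (Set.range I))
        (extChartAt I p p) := by
    intro V hV
    have := MDifferentiableWithinAt.differentiableWithinAt_mpullbackWithin_vectorField
      (s := Set.univ) hV.mdifferentiableWithinAt
    exact this.differentiableAt (by rw [Set.preimage_univ, Set.univ_inter, hr]; exact Filter.univ_mem)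
  have htarget : ∀ᶠ y in 𝓝 (extChartAt I p p), y ∈ (extChartAt I p).target := by
    have := extChartAt_target_mem_nhdsWithin (I := I) p
    rwa [hr, nhdsWithin_univ] at this
  have hzero : ∀ V : ∀ p : M, TangentSpace I p, (∀ᶠ q in 𝓝 p, mvfderiv I f q (V q) = 0) →
      (fun y => fderiv ℝ (f ∘ (extChartAt I p).symm) y
        (mpullbackWithin 𝓘(ℝ, E) I (extChartAt I p).symm V (Set.range I) y))
          =ᶠ[𝓝 (extChartAt I p p)] fun _ => 0 := by
    -- In the chart, the derivative of f along the pulled-back field is df(V), which vanishes on a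
    -- whole neighbourhood and so may be differentiated.
    intro V hV
    filter_upwards [hcont.eventually hV, hcont.eventually hf, htarget] with y hy hfy hyt
    have hinv := isInvertible_mfderivWithin_extChartAt_symm hyt
    have hd : MDifferentiableAt 𝓘(ℝ, E) I (extChartAt I p).symm y := by
      have := mdifferentiableWithinAt_extChartAt_symm hyt
      rwa [hr, mdifferentiableWithinAt_univ] at this
    have hcomp := mvfderiv_comp_apply y (hfy.mdifferentiableAt two_ne_zero) hd
      (mpullbackWithin 𝓘(ℝ, E) I (extChartAt I p).symm V (Set.range I) y)
    rw [mpullbackWithin_apply] at hcomp ⊢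
    have h2 : mfderiv 𝓘(ℝ, E) I (extChartAt I p).symm y
        ((mfderivWithin 𝓘(ℝ, E) I (extChartAt I p).symm (Set.range I) y).inverse
          (V ((extChartAt I p).symm y))) = V ((extChartAt I p).symm y) := by
      rw [← mfderivWithin_univ, ← hr]
      exact hinv.self_apply_inverse _
    rw [h2, hy] at hcomp
    rw [← hcomp, mvfderiv, mfderiv_eq_fderiv]
    rfl
  -- By symmetry of the second derivative, df([X, Y]) = X(df(Y)) - Y(df(X)), and both functions
  -- being differentiated vanish near the point.
  have hlie := fderiv_apply_lieBracket (𝕜 := ℝ) hf' (by simp) (hdiff Y hY) (hdiff X hX)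
  rw [(hzero X hfX).fderiv_eq, (hzero Y hfY).fderiv_eq] at hlie
  have hinv := isInvertible_mfderiv_extChartAt hps
  have hmd : MDifferentiableAt I 𝓘(ℝ, E) (extChartAt I p) p :=
    mdifferentiableAt_extChartAt (mem_chart_source H p)
  have hfd : MDifferentiableAt 𝓘(ℝ, E) 𝓘(ℝ, ℝ) (f ∘ (extChartAt I p).symm) (extChartAt I p p) :=
    (hf'.differentiableAt two_ne_zero).mdifferentiableAt
  have heq : mvfderiv I f p = mvfderiv I ((f ∘ (extChartAt I p).symm) ∘ extChartAt I p) p := by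
    have : f =ᶠ[𝓝 p] (f ∘ (extChartAt I p).symm) ∘ extChartAt I p := by
      filter_upwards [extChartAt_source_mem_nhds (I := I) p] with q hq
      simp only [Function.comp_apply, (extChartAt I p).left_inv hq]
    simp only [mvfderiv]
    rw [this.mfderiv_eq]
    rfl
  have hbr : mfderiv I 𝓘(ℝ, E) (extChartAt I p) p (mlieBracket I X Y p) =
      lieBracket ℝ (mpullbackWithin 𝓘(ℝ, E) I (extChartAt I p).symm X (Set.range I))
        (mpullbackWithin 𝓘(ℝ, E) I (extChartAt I p).symm Y (Set.range I)) (extChartAt I p p) := by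
    refine (hinv.self_apply_inverse _).trans ?_
    have hset : (extChartAt I p).symm ⁻¹' Set.univ ∩ Set.range I = Set.univ := by
      rw [Set.preimage_univ, Set.univ_inter, hr]
    exact (congrArg (fun s => lieBracketWithin ℝ
      (mpullbackWithin 𝓘(ℝ, E) I (extChartAt I p).symm X (Set.range I))
      (mpullbackWithin 𝓘(ℝ, E) I (extChartAt I p).symm Y (Set.range I)) s (extChartAt I p p))
      hset).trans (congrFun lieBracketWithin_univ _)
  rw [heq, mvfderiv_comp_apply p hfd hmd, hbr, mvfderiv, mfderiv_eq_fderiv]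
  refine Eq.trans hlie ?_
  rw [fderiv_fun_const]
  exact sub_zero (0 : ℝ)

/-! ### Differentiability of sections and of β♯. -/

/-- If `A` is a differentiable family of isomorphisms from a vector bundle to another, then a
section `s` is differentiable as soon as `A s` is. -/
theorem mdifferentiableAt_section_of_isInvertible
    {EB : Type*} [NormedAddCommGroup EB] [NormedSpace ℝ EB] {HB : Type*} [TopologicalSpace HB]
    {IB : ModelWithCorners ℝ EB HB} {B : Type*} [TopologicalSpace B] [ChartedSpace HB B]
    {F₁ : Type*} [NormedAddCommGroup F₁] [NormedSpace ℝ F₁] [CompleteSpace F₁]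
    {F₂ : Type*} [NormedAddCommGroup F₂] [NormedSpace ℝ F₂]
    {E₁ : B → Type*} [TopologicalSpace (TotalSpace F₁ E₁)] [∀ x, AddCommGroup (E₁ x)]
    [∀ x, Module ℝ (E₁ x)] [∀ x, TopologicalSpace (E₁ x)]
    [FiberBundle F₁ E₁] [VectorBundle ℝ F₁ E₁]
    {E₂ : B → Type*} [TopologicalSpace (TotalSpace F₂ E₂)] [∀ x, AddCommGroup (E₂ x)]
    [∀ x, Module ℝ (E₂ x)] [∀ x, TopologicalSpace (E₂ x)]
    [∀ x, IsTopologicalAddGroup (E₂ x)] [∀ x, ContinuousSMul ℝ (E₂ x)]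
    [FiberBundle F₂ E₂] [VectorBundle ℝ F₂ E₂]
    {A : ∀ q, E₁ q →L[ℝ] E₂ q} {s : ∀ q, E₁ q} {p : B} (hA : ∀ q, (A q).IsInvertible)
    (hAd : MDifferentiableAt IB (IB.prod 𝓘(ℝ, F₁ →L[ℝ] F₂))
      (fun q => TotalSpace.mk' (F₁ →L[ℝ] F₂) (E := fun q => E₁ q →L[ℝ] E₂ q) q (A q)) p)
    (hs : MDifferentiableAt IB (IB.prod 𝓘(ℝ, F₂)) (fun q => TotalSpace.mk' F₂ q (A q (s q))) p) :
    MDifferentiableAt IB (IB.prod 𝓘(ℝ, F₁)) (fun q => TotalSpace.mk' F₁ q (s q)) p := by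
  have hap := ((mdifferentiableAt_hom_bundle _).1 hAd).2
  -- In trivializations the matrix of A⁻¹ is the inverse of the matrix of A, and operator inversion
  -- is smooth at invertible operators. The two agree only over the common base set, hence
  -- eventually near p.
  have hϕ : MDifferentiableAt IB 𝓘(ℝ, F₂ →L[ℝ] F₁)
      (fun q => ContinuousLinearMap.inCoordinates F₂ E₂ F₁ E₁ p q p q (A q).inverse) p := by
    have hinv : MDifferentiableAt IB 𝓘(ℝ, F₂ →L[ℝ] F₁)
        (ContinuousLinearMap.inverse ∘ fun q =>
          ContinuousLinearMap.inCoordinates F₁ E₁ F₂ E₂ p q p q (A q)) p := by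
      refine MDifferentiableAt.comp p (ContMDiffAt.mdifferentiableAt (n := 1) ?_ one_ne_zero) hap
      apply ContDiffAt.contMDiffAt
      apply ContinuousLinearMap.IsInvertible.contDiffAt_map_inverse
      rw [ContinuousLinearMap.inCoordinates_eq (FiberBundle.mem_baseSet_trivializationAt' p)
        (FiberBundle.mem_baseSet_trivializationAt' p)]
      exact ContinuousLinearMap.isInvertible_equiv.comp
        ((hA p).comp ContinuousLinearMap.isInvertible_equiv)
    refine hinv.congr_of_eventuallyEq ?_
    filter_upwards [(trivializationAt F₁ E₁ p).open_baseSet.mem_nhds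
        (FiberBundle.mem_baseSet_trivializationAt' p),
      (trivializationAt F₂ E₂ p).open_baseSet.mem_nhds
        (FiberBundle.mem_baseSet_trivializationAt' p)] with q hq hq'
    simp only [Function.comp_apply]
    rw [ContinuousLinearMap.inCoordinates_eq hq hq', ContinuousLinearMap.inCoordinates_eq hq' hq]
    simp only [ContinuousLinearMap.inverse_equiv_comp, ContinuousLinearMap.inverse_comp_equiv,
      ContinuousLinearEquiv.symm_symm]
    rfl
  have := MDifferentiableAt.clm_apply_of_inCoordinates (b₁ := fun q : B => q) (b₂ := fun q : B => q)
    (ϕ := fun q => (A q).inverse) (v := fun q => A q (s q)) hϕ hs mdifferentiableAt_id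
  simpa only [(hA _).inverse_apply_self] using this

theorem ContinuousLinearMap.isInvertible_of_injective_of_finrank_eq {E F : Type*}
    [NormedAddCommGroup E] [NormedSpace ℝ E] [FiniteDimensional ℝ E]
    [NormedAddCommGroup F] [NormedSpace ℝ F] [FiniteDimensional ℝ F]
    (h : Module.finrank ℝ E = Module.finrank ℝ F) (B : E →L[ℝ] F)
    (hB : ∀ v, B v = 0 → v = 0) : B.IsInvertible := by
  have hinj : Function.Injective (B : E →ₗ[ℝ] F) := (injective_iff_map_eq_zero _).2 hB
  refine ⟨(LinearEquiv.ofInjectiveOfFinrankEq (B : E →ₗ[ℝ] F) hinj h).toContinuousLinearEquiv, ?_⟩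
  ext v
  rfl

namespace RandersFoliation

variable {m : ℕ} {M : Type*} [TopologicalSpace M] [ChartedSpace (Model m) M]
  [IsManifold (𝓡 (m + 1)) ∞ M]

theorem inner_isInvertible (a : Metric m M) (p : M) : (a.inner p).IsInvertible := by
  have h : Module.finrank ℝ (Model m) = Module.finrank ℝ (Model m →L[ℝ] ℝ) := by
    rw [← (LinearMap.toContinuousLinearMap (𝕜 := ℝ) (E := Model m) (F' := ℝ)).finrank_eq]
    exact (Subspace.dual_finrank_eq (K := ℝ) (V := Model m)).symm
  refine ContinuousLinearMap.isInvertible_of_injective_of_finrank_eq (E := Model m)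
    (F := Model m →L[ℝ] ℝ) h (a.inner p) fun v hv => ?_
  by_contra hne
  exact (a.pos p v hne).ne' (DFunLike.congr_fun hv v)

/-- β♯ is defined pointwise by choice; its regularity comes from inverting the smooth bundle map v ↦
⟨v, ·⟩, which sends β♯ to β. -/
theorem mdifferentiableAt_sharpField (a : Metric m M) {β : OneForm m M} (hβ : SmoothForm β)
    (p : M) :
    MDifferentiableAt (𝓡 (m + 1)) ((𝓡 (m + 1)).prod 𝓘(ℝ, Model m))
      (fun q => TotalSpace.mk' (Model m) q (sharpField a β q)) p := by
  have hsharp : ∀ q, a.inner q (sharpField a β q) = β q := fun q => by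
    ext u
    exact inner_sharp a q (β q) u
  refine mdifferentiableAt_section_of_isInvertible (inner_isInvertible a)
    ((a.contMDiff p).mdifferentiableAt (by simp)) ?_
  simp only [hsharp]
  exact (hβ p).mdifferentiableAt (by simp)

theorem mdifferentiableAt_inner (a : Metric m M) {X Y : VField m M} {p : M}
    (hX : MDifferentiableAt (𝓡 (m + 1)) ((𝓡 (m + 1)).prod 𝓘(ℝ, Model m))
      (fun q => TotalSpace.mk' (Model m) q (X q)) p)
    (hY : MDifferentiableAt (𝓡 (m + 1)) ((𝓡 (m + 1)).prod 𝓘(ℝ, Model m))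
      (fun q => TotalSpace.mk' (Model m) q (Y q)) p) :
    MDifferentiableAt (𝓡 (m + 1)) 𝓘(ℝ, ℝ) (fun q => a.inner q (X q) (Y q)) p := by
  have h := MDifferentiableAt.clm_bundle_apply₂ (F₁ := Model m) (F₂ := Model m) (F₃ := ℝ)
    (E₃ := fun _ : M => ℝ) ((a.contMDiff p).mdifferentiableAt (by simp)) hX hY
  simp only [mdifferentiableAt_totalSpace] at h
  exact h.2

end RandersFoliation

/-! ### The fundamental form of a Randers norm. -/

/-- The fundamental form of a Randers norm at a unit vector. -/
theorem RandersFoliation.fundamentalForm_randers {V : Type*} [AddCommGroup V] [Module ℝ V]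
    (B : V →ₗ[ℝ] V →ₗ[ℝ] ℝ) (hB : ∀ u v, B u v = B v u) (φ : V →ₗ[ℝ] ℝ) {y : V} (hy : B y y = 1)
    (u v : V) :
    fundamentalForm (fun y => Real.sqrt (B y y) + φ y) y u v =
      (1 + φ y) * B u v + φ u * φ v + φ u * B y v + φ v * B y u - φ y * B y u * B y v := by
  have hlin : ∀ (ψ : V →ₗ[ℝ] ℝ) (z w : V), HasDerivAt (fun t : ℝ => ψ (z + t • w)) (ψ w) 0 := by
    intro ψ z w
    rw [show (fun t : ℝ => ψ (z + t • w)) = fun t => ψ z + t * ψ w by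
      ext t; simp]
    exact (((hasDerivAt_id (0 : ℝ)).mul_const (ψ w)).const_add (ψ z)).congr_deriv (by simp)
  have hsqrt : ∀ z w : V, 0 < B z z →
      HasDerivAt (fun t : ℝ => Real.sqrt (B (z + t • w) (z + t • w)))
        (B z w / Real.sqrt (B z z)) 0 := by
    intro z w hz
    rw [show (fun t : ℝ => Real.sqrt (B (z + t • w) (z + t • w))) =
        fun t => Real.sqrt (B z z + t * (2 * B z w) + t * t * B w w) by
      ext t
      simp only [map_add, map_smul, LinearMap.add_apply, LinearMap.smul_apply, smul_eq_mul, hB w z]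
      ring_nf]
    have h1 : HasDerivAt (fun t : ℝ => B z z + t * (2 * B z w) + t * t * B w w) (2 * B z w) 0 :=
      ((((hasDerivAt_id (0 : ℝ)).mul_const (2 * B z w)).const_add (B z z)).add
        (((hasDerivAt_id (0 : ℝ)).mul (hasDerivAt_id 0)).mul_const (B w w))).congr_deriv (by simp)
    refine (h1.sqrt (by simpa using hz.ne')).congr_deriv ?_
    simp only [zero_mul, add_zero]
    have : Real.sqrt (B z z) ≠ 0 := (Real.sqrt_pos.2 hz).ne'
    field_simp
  -- B is not assumed positive definite; positivity at y spreads to small s by continuity, which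
  -- suffices for the outer derivative at 0.
  have hpos : ∀ᶠ s : ℝ in nhds 0, 0 < B (y + s • u) (y + s • u) := by
    have hc : Continuous fun s : ℝ => B (y + s • u) (y + s • u) := by
      simp only [map_add, map_smul, LinearMap.add_apply, LinearMap.smul_apply, smul_eq_mul]
      fun_prop
    exact hc.continuousAt.eventually (lt_mem_nhds (by simp [hy]))
  have hfirst : (fun s : ℝ => deriv (fun t : ℝ =>
      (Real.sqrt (B (y + s • u + t • v) (y + s • u + t • v)) + φ (y + s • u + t • v)) ^ 2) 0)
      =ᶠ[nhds 0] fun s => 2 * (Real.sqrt (B (y + s • u) (y + s • u)) + φ (y + s • u)) *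
        (B (y + s • u) v / Real.sqrt (B (y + s • u) (y + s • u)) + φ v) := by
    filter_upwards [hpos] with s hs
    have h := ((hsqrt (y + s • u) v hs).add (hlin φ (y + s • u) v)).pow 2
    refine h.deriv.trans ?_
    simp only [Pi.add_apply, zero_smul, add_zero]
    norm_num
  have hy0 : 0 < B y y := by rw [hy]; exact one_pos
  have hd : HasDerivAt (fun s : ℝ =>
      2 * (Real.sqrt (B (y + s • u) (y + s • u)) + φ (y + s • u)) *
        (B (y + s • u) v / Real.sqrt (B (y + s • u) (y + s • u)) + φ v)) _ 0 :=
    (((hsqrt y u hy0).add (hlin φ y u)).const_mul 2).mul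
      (((hlin (B.flip v) y u).div (hsqrt y u hy0) (by simp [hy])).add_const (φ v))
  unfold fundamentalForm
  rw [hfirst.deriv_eq, hd.deriv]
  simp only [zero_smul, add_zero, hy, Real.sqrt_one, Pi.add_apply,
    LinearMap.flip_apply]
  ring

/-! ### The Finsler normal and the induced metric. -/

namespace RandersFoliation

variable {m : ℕ} {M : Type*} [TopologicalSpace M] [ChartedSpace (Model m) M]
  [IsManifold (𝓡 (m + 1)) ∞ M] {a : Metric m M} {β : OneForm m M} {ℱ : CodimOneFoliation m M}
  {N n : VField m M} {p : M}

/-- The vector field `X` is differentiable at `p`. -/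
abbrev DiffFieldAt (X : VField m M) (p : M) : Prop :=
  MDifferentiableAt (𝓡 (m + 1)) ((𝓡 (m + 1)).prod 𝓘(ℝ, Model m))
    (fun q => TotalSpace.mk' (Model m) q (X q)) p

theorem formNorm_sq (a : Metric m M) (β : OneForm m M) (p : M) :
    formNorm a β p ^ 2 = a.inner p (sharpField a β p) (sharpField a β p) := by
  refine Real.sq_sqrt ?_
  by_cases h : sharpField a β p = 0
  · simp [h]
  · exact (a.pos p _ h).le

theorem one_sub_formNorm_sq_pos (h : formNorm a β p < 1) : 0 < 1 - formNorm a β p ^ 2 := by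
  have h0 : 0 ≤ formNorm a β p := Real.sqrt_nonneg _
  nlinarith

theorem cFun_pos (h : formNorm a β p < 1) : 0 < cFun a β p :=
  Real.sqrt_pos.2 (one_sub_formNorm_sq_pos h)

theorem cFun_sq (h : formNorm a β p < 1) :
    cFun a β p ^ 2 = 1 - a.inner p (sharpField a β p) (sharpField a β p) := by
  rw [← formNorm_sq]
  exact Real.sq_sqrt (one_sub_formNorm_sq_pos h).le

theorem inner_sharpField (a : Metric m M) (β : OneForm m M) (p : M)
    (u : TangentSpace (𝓡 (m + 1)) p) : a.inner p (sharpField a β p) u = β p u :=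
  inner_sharp a p (β p) u

theorem inner_ext {x y : TangentSpace (𝓡 (m + 1)) p} (h : ∀ w, a.inner p x w = a.inner p y w) :
    x = y := by
  by_contra hne
  have := a.pos p (x - y) (sub_ne_zero.2 hne)
  simp [h] at this

/-- The leaf directions are ker df and are orthogonal to N. So df(N) ≠ 0, since otherwise N would be
orthogonal to itself, and removing a multiple of N from v to land in ker df shows that df is
proportional to ⟨N, ·⟩. -/
theorem IsUnitNormal.exists_defining_function (hN : IsUnitNormal a ℱ N) (p : M) :
    ∃ (U : Set M) (f : M → ℝ), IsOpen U ∧ p ∈ U ∧ ContMDiffOn (𝓡 (m + 1)) 𝓘(ℝ, ℝ) ∞ f U ∧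
      ∀ q ∈ U, mvfderiv (𝓡 (m + 1)) f q (N q) ≠ 0 ∧
        (∀ v, v ∈ ℱ.tangent q ↔ mvfderiv (𝓡 (m + 1)) f q v = 0) ∧
        ∀ v, mvfderiv (𝓡 (m + 1)) f q v =
          mvfderiv (𝓡 (m + 1)) f q (N q) * a.inner q (N q) v := by
  obtain ⟨U, f, hU, hp, hf, h⟩ := ℱ.locally_level_sets p
  refine ⟨U, f, hU, hp, hf, fun q hq => ?_⟩
  have hne : mvfderiv (𝓡 (m + 1)) f q (N q) ≠ 0 := by
    intro h0
    have := hN.normal q (N q) (((h q hq).2 _).2 h0)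
    rw [hN.unit q] at this
    exact one_ne_zero this
  refine ⟨hne, (h q hq).2, fun v => ?_⟩
  have hw : v - (mvfderiv (𝓡 (m + 1)) f q v / mvfderiv (𝓡 (m + 1)) f q (N q)) • N q ∈
      ℱ.tangent q := by
    rw [(h q hq).2, map_sub, map_smul, smul_eq_mul, div_mul_cancel₀ _ hne, sub_self]
  have := hN.normal q _ hw
  rw [map_sub, map_smul, smul_eq_mul, hN.unit q] at this
  rw [sub_eq_zero.1 this]
  field_simp

theorem IsUnitNormal.mem_tangent_iff (hN : IsUnitNormal a ℱ N)
    {v : TangentSpace (𝓡 (m + 1)) p} : v ∈ ℱ.tangent p ↔ a.inner p (N p) v = 0 := by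
  obtain ⟨U, f, -, hp, -, h⟩ := hN.exists_defining_function p
  obtain ⟨hne, h1, h2⟩ := h p hp
  rw [h1, h2]
  simp [hne]

/-- Involutivity of the foliation: both fields annihilate a local defining function, hence so does
their bracket. -/
theorem IsUnitNormal.inner_mlieBracket (hN : IsUnitNormal a ℱ N) {X Y : VField m M}
    (hX : DiffFieldAt X p) (hY : DiffFieldAt Y p)
    (hNX : ∀ q, a.inner q (N q) (X q) = 0) (hNY : ∀ q, a.inner q (N q) (Y q) = 0) :
    a.inner p (N p) (VectorField.mlieBracket (𝓡 (m + 1)) X Y p) = 0 := by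
  obtain ⟨U, f, hU, hp, hf, h⟩ := hN.exists_defining_function p
  have hUp : ∀ᶠ q in nhds p, q ∈ U := hU.mem_nhds hp
  have : IsManifold (𝓡 (m + 1)) 2 M := IsManifold.of_le (n := ∞) ENat.LEInfty.out
  have hb := mvfderiv_mlieBracket_eq_zero (I := 𝓡 (m + 1)) (f := f) (p := p)
    (hUp.mono fun q hq => ((hf q hq).contMDiffAt (hU.mem_nhds hq)).of_le
      ENat.LEInfty.out) hX hY
    (hUp.mono fun q hq => by rw [(h q hq).2.2, hNX, mul_zero])
    (hUp.mono fun q hq => by rw [(h q hq).2.2, hNY, mul_zero])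
  rw [(h p hp).2.2] at hb
  exact (mul_eq_zero.1 hb).resolve_left (h p hp).1

/-- The fundamental form of the Randers norm at an `a`-unit vector. -/
theorem fundamentalForm_randersNorm (a : Metric m M) (β : OneForm m M)
    {y : TangentSpace (𝓡 (m + 1)) p} (hy : a.inner p y y = 1) (u v : TangentSpace (𝓡 (m + 1)) p) :
    fundamentalForm (randersNorm a β p) y u v =
      (1 + β p y) * a.inner p u v + β p u * β p v + β p u * a.inner p y v + β p v * a.inner p y u
        - β p y * a.inner p y u * a.inner p y v :=
  fundamentalForm_randers
    (LinearMap.mk₂ ℝ (fun u v => a.inner p u v) (by simp) (by simp) (by simp) (by simp))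
    (fun u v => a.symm p u v) (β p : TangentSpace (𝓡 (m + 1)) p →ₗ[ℝ] ℝ) hy u v

theorem IsFinslerNormal.eq_smul_sub (hβ1 : ∀ p, formNorm a β p < 1) (hN : IsUnitNormal a ℱ N)
    (hβN : ∀ p, β p (N p) = 0) (hn : IsFinslerNormal a β ℱ N n) :
    n = cFun a β • N - sharpField a β := by
  ext1 p
  have hc := cFun_pos (hβ1 p)
  have hc2 := cFun_sq (hβ1 p)
  have hbN : a.inner p (sharpField a β p) (N p) = 0 := by rw [inner_sharpField, hβN]
  -- `n + β♯` is orthogonal to the leaf, because `1 + β(n) > 0` by the Cauchy-Schwarz inequality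
  have hCS : 0 < 1 + β p (n p) := by
    by_contra hle
    have hbb : 0 ≤ a.inner p (n p + sharpField a β p) (n p + sharpField a β p) := by
      by_cases h : n p + sharpField a β p = 0
      · simp [h]
      · exact (a.pos p _ h).le
    simp only [map_add, add_apply, hn.unit p,
      a.symm p (n p) (sharpField a β p), inner_sharpField] at hbb
    rw [inner_sharpField] at hc2
    nlinarith
  have horth : ∀ w ∈ ℱ.tangent p, a.inner p (n p) w + β p w = 0 := by
    intro w hw
    have h := hn.normal p w hw
    rw [fundamentalForm_randersNorm a β (hn.unit p), hn.unit p] at h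
    have : (1 + β p (n p)) * (a.inner p (n p) w + β p w) = 0 := by linear_combination h
    exact (mul_eq_zero.1 this).resolve_left hCS.ne'
  have hperp : ∀ w, a.inner p (n p) w + β p w = a.inner p (n p) (N p) * a.inner p (N p) w := by
    intro w
    have hw : w - a.inner p (N p) w • N p ∈ ℱ.tangent p := by
      rw [hN.mem_tangent_iff, map_sub, map_smul, hN.unit p]
      simp
    have h := horth _ hw
    simp only [map_sub, map_smul, smul_eq_mul, hβN] at h
    linear_combination h
  -- Testing `hperp` on n gives 1 + β(n) = ⟨n, N⟩², and on β♯ gives β(n) = -‖β‖². The side condition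
  -- then selects the positive root c.
  have hnN : a.inner p (n p) (N p) = cFun a β p := by
    have h1 := hperp (n p)
    have h2 := hperp (sharpField a β p)
    rw [hn.unit p, a.symm p (N p) (n p)] at h1
    rw [a.symm p (n p), inner_sharpField, a.symm p (N p), hbN, ← inner_sharpField a β p
      (sharpField a β p)] at h2
    have : a.inner p (n p) (N p) ^ 2 = cFun a β p ^ 2 := by rw [hc2]; linear_combination h2 - h1
    exact (pow_left_inj₀ (hn.same_side p).le hc.le two_ne_zero).1 this
  refine inner_ext (a := a) fun w => ?_
  have := hperp w
  rw [hnN] at this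
  simp only [Pi.sub_apply, Pi.smul_apply', map_sub, map_smul, sub_apply,
    smul_apply, smul_eq_mul, inner_sharpField]
  linear_combination this

/-- The metric `g_n` for `n = c N - β♯`. -/
theorem inducedMetric_apply (hβ1 : ∀ p, formNorm a β p < 1) (hN : IsUnitNormal a ℱ N)
    (hβN : ∀ p, β p (N p) = 0) (hn : IsFinslerNormal a β ℱ N n) (p : M)
    (u v : TangentSpace (𝓡 (m + 1)) p) :
    inducedMetric a β n p u v = cFun a β p ^ 2 * (a.inner p u v - β p u * β p v) +
      cFun a β p ^ 3 * (β p u * a.inner p (N p) v + a.inner p (N p) u * β p v) +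
      (1 - cFun a β p ^ 2) * cFun a β p ^ 2 * a.inner p (N p) u * a.inner p (N p) v := by
  have hc2 := cFun_sq (hβ1 p)
  rw [inner_sharpField] at hc2
  rw [inducedMetric, fundamentalForm_randersNorm a β (hn.unit p), hn.eq_smul_sub hβ1 hN hβN]
  simp only [Pi.sub_apply, Pi.smul_apply', map_sub, map_smul, sub_apply, smul_apply, smul_eq_mul,
    inner_sharpField, hβN]
  have : β p (sharpField a β p) = 1 - cFun a β p ^ 2 := by linarith
  rw [this]
  ring

theorem randersNorm_finslerNormal (hβ1 : ∀ p, formNorm a β p < 1) (hN : IsUnitNormal a ℱ N)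
    (hβN : ∀ p, β p (N p) = 0) (hn : IsFinslerNormal a β ℱ N n) (p : M) :
    randersNorm a β p (n p) = cFun a β p ^ 2 := by
  rw [randersNorm, hn.unit p, Real.sqrt_one, hn.eq_smul_sub hβ1 hN hβN, cFun_sq (hβ1 p)]
  simp only [Pi.sub_apply, Pi.smul_apply', map_sub, map_smul, smul_eq_mul, hβN, inner_sharpField]
  ring

theorem finslerUnit_eq (hβ1 : ∀ p, formNorm a β p < 1) (hN : IsUnitNormal a ℱ N)
    (hβN : ∀ p, β p (N p) = 0) (hn : IsFinslerNormal a β ℱ N n) :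
    finslerUnit a β n = (fun q => (cFun a β q ^ 2)⁻¹) • n := by
  ext1 q
  simp only [finslerUnit, randersNorm_finslerNormal hβ1 hN hβN hn, Pi.smul_apply']

theorem IsUnitNormal.diffFieldAt (hN : IsUnitNormal a ℱ N) (p : M) : DiffFieldAt N p :=
  (hN.smooth p).mdifferentiableAt (by simp)

theorem mdifferentiableAt_cFun (hβ : SmoothForm β) (hβ1 : ∀ p, formNorm a β p < 1) (p : M) :
    MDifferentiableAt (𝓡 (m + 1)) 𝓘(ℝ, ℝ) (cFun a β) p := by
  have hb := mdifferentiableAt_sharpField a hβ p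
  have h := (mdifferentiableAt_const (c := (1 : ℝ))).sub (mdifferentiableAt_inner a hb hb)
  have hs : DifferentiableAt ℝ Real.sqrt
      (1 - a.inner p (sharpField a β p) (sharpField a β p)) := by
    refine (Real.hasDerivAt_sqrt ?_).differentiableAt
    rw [← formNorm_sq]
    exact (one_sub_formNorm_sq_pos (hβ1 p)).ne'
  have := MDifferentiableAt.comp p hs.mdifferentiableAt h
  refine this.congr_of_eventuallyEq (Filter.Eventually.of_forall fun q => ?_)
  simp only [cFun, formNorm_sq, Function.comp_apply, Pi.sub_apply]

theorem diffFieldAt_finslerNormal (hβ : SmoothForm β) (hβ1 : ∀ p, formNorm a β p < 1)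
    (hN : IsUnitNormal a ℱ N) (hβN : ∀ p, β p (N p) = 0) (hn : IsFinslerNormal a β ℱ N n)
    (p : M) : DiffFieldAt n p := by
  rw [hn.eq_smul_sub hβ1 hN hβN]
  exact mdifferentiableAt_sub_section
    ((mdifferentiableAt_cFun hβ hβ1 p).smul_section (hN.diffFieldAt p))
    (mdifferentiableAt_sharpField a hβ p)

theorem mdifferentiableAt_inv_cFun_sq (hβ : SmoothForm β) (hβ1 : ∀ p, formNorm a β p < 1)
    (p : M) : MDifferentiableAt (𝓡 (m + 1)) 𝓘(ℝ, ℝ) (fun q => (cFun a β q ^ 2)⁻¹) p := by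
  have hs : DifferentiableAt ℝ (fun x : ℝ => (x ^ 2)⁻¹) (cFun a β p) :=
    (differentiableAt_id.pow 2).inv (pow_ne_zero 2 (cFun_pos (hβ1 p)).ne')
  exact MDifferentiableAt.comp (g := fun x : ℝ => (x ^ 2)⁻¹) p hs.mdifferentiableAt
    (mdifferentiableAt_cFun hβ hβ1 p)

/-! ### Derivatives of c, N, β♯ and ν. -/

theorem Connection.sub (D : Connection m M) {X Y : VField m M} (hX : DiffFieldAt X p)
    (hY : DiffFieldAt Y p) : D (X - Y) p = D X p - D Y p := by
  have hD := D.isCovariantDerivativeOnUniv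
  have hY' : DiffFieldAt ((-1 : ℝ) • Y) p := by
    rw [neg_one_smul]
    exact mdifferentiableAt_neg_section hY
  have := hD.add hX hY'
  rw [hD.smul_const (-1) hY] at this
  simpa [sub_eq_add_neg] using this

theorem IsLeviCivita.mvfderiv_inner {D : Connection m M}
    (hD : IsLeviCivita (fun p u v => a.inner p u v) D) {X Y : VField m M} (hX : DiffFieldAt X p)
    (hY : DiffFieldAt Y p) (w : TangentSpace (𝓡 (m + 1)) p) :
    mvfderiv (𝓡 (m + 1)) (fun q => a.inner q (X q) (Y q)) p w =
      a.inner p (D X p w) (Y p) + a.inner p (X p) (D Y p w) :=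
  hD.2 X Y p hX hY w

theorem IsLeviCivita.torsion_free
    {g : ∀ p : M, TangentSpace (𝓡 (m + 1)) p → TangentSpace (𝓡 (m + 1)) p → ℝ}
    {D : Connection m M} (hD : IsLeviCivita g D) {X Y : VField m M} (hX : DiffFieldAt X p)
    (hY : DiffFieldAt Y p) :
    D Y p (X p) - D X p (Y p) = VectorField.mlieBracket (𝓡 (m + 1)) X Y p :=
  (CovariantDerivative.torsion_eq_zero_iff D).1 hD.1 hX hY

/-- Obtained by differentiating c² = 1 - ⟨β♯, β♯⟩; it trades β(D_w β♯) for the derivative of c. -/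
theorem cFun_mul_mvfderiv_cFun {D : Connection m M} (hβ : SmoothForm β)
    (hβ1 : ∀ p, formNorm a β p < 1) (hD : IsLeviCivita (fun p u v => a.inner p u v) D) (p : M)
    (w : TangentSpace (𝓡 (m + 1)) p) :
    cFun a β p * mvfderiv (𝓡 (m + 1)) (cFun a β) p w =
      - β p (D (sharpField a β) p w) := by
  have hb := mdifferentiableAt_sharpField a hβ p
  have hc := mdifferentiableAt_cFun hβ hβ1 p
  have h1 : (fun q => cFun a β q * cFun a β q) =
      fun q => (fun _ : M => (1 : ℝ)) q - a.inner q (sharpField a β q) (sharpField a β q) := by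
    ext q
    rw [← cFun_sq (hβ1 q), sq]
  have h2 := congrArg (fun f => mvfderiv (𝓡 (m + 1)) f p w) h1
  simp only at h2
  rw [mvfderiv_fun_mul hc hc, mvfderiv_fun_sub mdifferentiableAt_const
    (mdifferentiableAt_inner a hb hb), mvfderiv_const] at h2
  simp only [add_apply, sub_apply, smul_apply, smul_eq_mul, zero_apply] at h2
  rw [hD.mvfderiv_inner hb hb w, a.symm p _ (sharpField a β p), inner_sharpField] at h2
  linarith

/-- A vector tangent to the leaf extends to a differentiable field tangent to the leaves. -/
theorem IsUnitNormal.exists_tangent_extension (hN : IsUnitNormal a ℱ N)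
    {u : TangentSpace (𝓡 (m + 1)) p} (hu : a.inner p (N p) u = 0) :
    ∃ X : VField m M, DiffFieldAt X p ∧ X p = u ∧ ∀ q, a.inner q (N q) (X q) = 0 := by
  have he : DiffFieldAt (FiberBundle.extend (Model m) u) p :=
    FiberBundle.mdifferentiableAt_extend (𝓡 (m + 1)) (Model m) u
  refine ⟨FiberBundle.extend (Model m) u -
    (fun q => a.inner q (N q) (FiberBundle.extend (Model m) u q)) • N, ?_, ?_, fun q => ?_⟩
  · exact mdifferentiableAt_sub_section he
      ((mdifferentiableAt_inner a (hN.diffFieldAt p) he).smul_section (hN.diffFieldAt p))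
  · simp [hu]
  · simp [hN.unit q]

/-- The Koszul-type formula for the second fundamental form: the Lie derivative of `g` along the
unit normal. -/
theorem two_mul_inner_deriv_unitNormal
    {g : ∀ p : M, TangentSpace (𝓡 (m + 1)) p → TangentSpace (𝓡 (m + 1)) p → ℝ}
    {Da Dg : Connection m M} (hDa : IsLeviCivita (fun p u v => a.inner p u v) Da)
    (hDg : IsLeviCivita g Dg)
    (hg_symm : ∀ u v, g p u v = g p v u) (hg_sub : ∀ u v w, g p (u - v) w = g p u w - g p v w)
    {ν X Y : VField m M} {k : ℝ} (hgν : ∀ w, g p (ν p) w = k * a.inner p (N p) w)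
    (hN : IsUnitNormal a ℱ N) (hν : DiffFieldAt ν p) (hX : DiffFieldAt X p) (hY : DiffFieldAt Y p)
    (hNX : ∀ q, a.inner q (N q) (X q) = 0) (hNY : ∀ q, a.inner q (N q) (Y q) = 0)
    (hνX : ∀ q, g q (ν q) (X q) = 0) (hνY : ∀ q, g q (ν q) (Y q) = 0) :
    2 * g p (Dg ν p (X p)) (Y p) =
      mvfderiv (𝓡 (m + 1)) (fun q => g q (X q) (Y q)) p (ν p)
        - g p (Da X p (ν p) - Da ν p (X p)) (Y p) - g p (X p) (Da Y p (ν p) - Da ν p (Y p)) := by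
  have e1 := hDg.2 ν Y p hν hY (X p)
  have e2 := hDg.2 ν X p hν hX (Y p)
  have e3 := hDg.2 X Y p hX hY (ν p)
  have z1 : (fun q => g q (ν q) (Y q)) = fun _ => 0 := funext hνY
  have z2 : (fun q => g q (ν q) (X q)) = fun _ => 0 := funext hνX
  rw [z1, mvfderiv_const, zero_apply, hgν] at e1
  rw [z2, mvfderiv_const, zero_apply, hgν] at e2
  -- Both connections compute the same brackets [ν, X] and [ν, Y]. Integrability enters through
  -- `t3`: [X, Y] has no normal part, so g(∇_X ν, Y) is symmetric in X and Y.
  have t1 := (hDg.torsion_free hν hX).trans (hDa.torsion_free hν hX).symm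
  have t2 := (hDg.torsion_free hν hY).trans (hDa.torsion_free hν hY).symm
  have t3 := hN.inner_mlieBracket hX hY hNX hNY
  rw [← hDg.torsion_free hX hY, map_sub] at t3
  rw [← t1, ← t2, hg_symm (X p), hg_sub, hg_sub, e3, hg_symm (X p)]
  linear_combination e2 - e1 - k * t3

/-- Differentiating ⟨N, X⟩ = ⟨N, Y⟩ = 0 reduces the difference of the two sides to ⟨N, [X, Y]⟩,
which vanishes by involutivity. -/
theorem inner_deriv_unitNormal_symm {D : Connection m M}
    (hD : IsLeviCivita (fun p u v => a.inner p u v) D) (hN : IsUnitNormal a ℱ N)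
    {u v : TangentSpace (𝓡 (m + 1)) p} (hu : a.inner p (N p) u = 0) (hv : a.inner p (N p) v = 0) :
    a.inner p (D N p u) v = a.inner p (D N p v) u := by
  obtain ⟨X, hX, rfl, hNX⟩ := hN.exists_tangent_extension hu
  obtain ⟨Y, hY, rfl, hNY⟩ := hN.exists_tangent_extension hv
  have e1 := hD.mvfderiv_inner (hN.diffFieldAt p) hY (X p)
  have e2 := hD.mvfderiv_inner (hN.diffFieldAt p) hX (Y p)
  rw [funext hNY, mvfderiv_const, zero_apply] at e1
  rw [funext hNX, mvfderiv_const, zero_apply] at e2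
  have t3 := hN.inner_mlieBracket hX hY hNX hNY
  rw [← hD.torsion_free hX hY, map_sub] at t3
  linear_combination e2 - e1 - t3

theorem inner_deriv_unitNormal_self {D : Connection m M}
    (hD : IsLeviCivita (fun p u v => a.inner p u v) D) (hN : IsUnitNormal a ℱ N)
    (w : TangentSpace (𝓡 (m + 1)) p) : a.inner p (N p) (D N p w) = 0 := by
  have e := hD.mvfderiv_inner (hN.diffFieldAt p) (hN.diffFieldAt p) w
  rw [funext hN.unit, mvfderiv_const, zero_apply, a.symm p (D N p w)] at e
  linarith

theorem inner_normal_deriv_sharpField {D : Connection m M} (hβ : SmoothForm β)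
    (hD : IsLeviCivita (fun p u v => a.inner p u v) D) (hN : IsUnitNormal a ℱ N)
    (hβN : ∀ p, β p (N p) = 0) (w : TangentSpace (𝓡 (m + 1)) p) :
    a.inner p (N p) (D (sharpField a β) p w) = - β p (D N p w) := by
  have e := hD.mvfderiv_inner (mdifferentiableAt_sharpField a hβ p) (hN.diffFieldAt p) w
  simp only [inner_sharpField] at e
  rw [funext hβN, mvfderiv_const, zero_apply, a.symm p _ (N p)] at e
  linarith

/-- This makes g-orthogonality to ν the same as a-orthogonality to N. -/
theorem inducedMetric_finslerUnit (hβ1 : ∀ p, formNorm a β p < 1) (hN : IsUnitNormal a ℱ N)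
    (hβN : ∀ p, β p (N p) = 0) (hn : IsFinslerNormal a β ℱ N n) (p : M)
    (w : TangentSpace (𝓡 (m + 1)) p) :
    inducedMetric a β n p (finslerUnit a β n p) w = cFun a β p * a.inner p (N p) w := by
  have hc := (cFun_pos (hβ1 p)).ne'
  have hc2 := cFun_sq (hβ1 p)
  rw [inner_sharpField] at hc2
  have hbN : a.inner p (N p) (sharpField a β p) = 0 := by
    rw [a.symm, inner_sharpField, hβN]
  have hbb : β p (sharpField a β p) = 1 - cFun a β p ^ 2 := by linarith
  rw [inducedMetric_apply hβ1 hN hβN hn, finslerUnit_eq hβ1 hN hβN hn,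
    hn.eq_smul_sub hβ1 hN hβN]
  simp only [Pi.sub_apply, Pi.smul_apply', map_sub, map_smul, sub_apply, smul_apply, smul_eq_mul,
    inner_sharpField, hβN, hN.unit, hbN, hbb]
  field_simp
  ring

/-- The `g`-derivative of the unit normal `ν` is tangent to the leaf. -/
theorem inner_normal_deriv_finslerUnit (hβ : SmoothForm β) (hβ1 : ∀ p, formNorm a β p < 1)
    (hN : IsUnitNormal a ℱ N)
    (hβN : ∀ p, β p (N p) = 0) (hn : IsFinslerNormal a β ℱ N n)
    {Dg : Connection m M} (hDg : IsLeviCivita (inducedMetric a β n) Dg)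
    (u : TangentSpace (𝓡 (m + 1)) p) :
    a.inner p (N p) (Dg (finslerUnit a β n) p u) = 0 := by
  have hν : DiffFieldAt (finslerUnit a β n) p := by
    rw [finslerUnit_eq hβ1 hN hβN hn]
    exact (mdifferentiableAt_inv_cFun_sq hβ hβ1 p).smul_section
      (diffFieldAt_finslerNormal hβ hβ1 hN hβN hn p)
  -- g(ν, ν) = c ⟨N, c⁻² (c N - β♯)⟩ = 1. Its derivative vanishes, so ∇_u ν is g-orthogonal to ν,
  -- hence a-orthogonal to N.
  have hunit : ∀ q, inducedMetric a β n q (finslerUnit a β n q) (finslerUnit a β n q) = 1 := by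
    intro q
    have hc := (cFun_pos (hβ1 q)).ne'
    rw [inducedMetric_finslerUnit hβ1 hN hβN hn, finslerUnit_eq hβ1 hN hβN hn,
      hn.eq_smul_sub hβ1 hN hβN]
    simp only [Pi.sub_apply, Pi.smul_apply', map_sub, map_smul, smul_eq_mul, hN.unit]
    rw [a.symm q (N q), inner_sharpField, hβN]
    field_simp
    ring
  have e := hDg.2 _ _ p hν hν u
  have hsymm : ∀ w, inducedMetric a β n p w (finslerUnit a β n p) =
      inducedMetric a β n p (finslerUnit a β n p) w := by
    intro w
    rw [inducedMetric_apply hβ1 hN hβN hn, inducedMetric_apply hβ1 hN hβN hn, a.symm p w]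
    ring
  rw [funext hunit, mvfderiv_const, zero_apply, hsymm, inducedMetric_finslerUnit hβ1 hN hβN hn] at e
  have : cFun a β p * a.inner p (N p) (Dg (finslerUnit a β n) p u) = 0 := by linarith
  exact (mul_eq_zero.1 this).resolve_left (cFun_pos (hβ1 p)).ne'

-- The product rule in the shape taken by g on leaf fields, c² (⟨X, Y⟩ - β(X) β(Y)).
omit [IsManifold (𝓡 (m + 1)) ∞ M] in
theorem mvfderiv_sq_mul_sub {c f h k : M → ℝ} (hc : MDifferentiableAt (𝓡 (m + 1)) 𝓘(ℝ, ℝ) c p)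
    (hf : MDifferentiableAt (𝓡 (m + 1)) 𝓘(ℝ, ℝ) f p)
    (hh : MDifferentiableAt (𝓡 (m + 1)) 𝓘(ℝ, ℝ) h p)
    (hk : MDifferentiableAt (𝓡 (m + 1)) 𝓘(ℝ, ℝ) k p) (w : TangentSpace (𝓡 (m + 1)) p) :
    mvfderiv (𝓡 (m + 1)) (fun q => c q * c q * (f q - h q * k q)) p w =
      2 * c p * mvfderiv (𝓡 (m + 1)) c p w * (f p - h p * k p) +
        c p ^ 2 * (mvfderiv (𝓡 (m + 1)) f p w - (mvfderiv (𝓡 (m + 1)) h p w * k p +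
          h p * mvfderiv (𝓡 (m + 1)) k p w)) := by
  change mvfderiv (𝓡 (m + 1)) (c * c * (f - h * k)) p w = _
  rw [mvfderiv_mul (hc.mul hc) (hf.sub (hh.mul hk)), mvfderiv_mul hc hc,
    mvfderiv_sub hf (hh.mul hk), mvfderiv_mul hh hk]
  simp only [add_apply, sub_apply, smul_apply, smul_eq_mul, Pi.mul_apply, Pi.sub_apply]
  ring

/-! ### The second fundamental form for g. -/

set_option maxHeartbeats 1600000 in
/-- The second fundamental form of the leaf for the metric `g`. -/
theorem second_fundamental_form (hβ : SmoothForm β) (hβ1 : ∀ p, formNorm a β p < 1)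
    (hN : IsUnitNormal a ℱ N) (hβN : ∀ p, β p (N p) = 0) (hn : IsFinslerNormal a β ℱ N n)
    {Da : Connection m M} (hDa : IsLeviCivita (fun p u v => a.inner p u v) Da)
    {Dg : Connection m M} (hDg : IsLeviCivita (inducedMetric a β n) Dg)
    {u v : TangentSpace (𝓡 (m + 1)) p} (hu : a.inner p (N p) u = 0) (hv : a.inner p (N p) v = 0) :
    2 * cFun a β p ^ 4 * (a.inner p v (Dg (finslerUnit a β n) p u) -
        β p (Dg (finslerUnit a β n) p u) * β p v) =
      2 * cFun a β p * mvfderiv (𝓡 (m + 1)) (cFun a β) p (n p) * (a.inner p u v - β p u * β p v)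
      + 2 * cFun a β p ^ 3 * a.inner p v (Da N p u)
      - cFun a β p ^ 2 * (a.inner p v (Da (sharpField a β) p u)
          + a.inner p u (Da (sharpField a β) p v))
      + β p u * (cFun a β p ^ 3 * a.inner p v (Da N p (n p))
          - cFun a β p ^ 2 * a.inner p v (Da (sharpField a β) p (n p)))
      + β p v * (cFun a β p ^ 3 * a.inner p u (Da N p (n p))
          - cFun a β p ^ 2 * a.inner p u (Da (sharpField a β) p (n p))) := by
  have hc := (cFun_pos (hβ1 p)).ne'
  have hcd := mdifferentiableAt_cFun hβ hβ1 p
  have hb := mdifferentiableAt_sharpField a hβ p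
  have hNd := hN.diffFieldAt p
  have hnd := diffFieldAt_finslerNormal hβ hβ1 hN hβN hn p
  have hφ := mdifferentiableAt_inv_cFun_sq hβ hβ1 p
  have hν : DiffFieldAt (finslerUnit a β n) p := by
    rw [finslerUnit_eq hβ1 hN hβN hn]
    exact hφ.smul_section hnd
  have hνp : finslerUnit a β n p = (cFun a β p ^ 2)⁻¹ • n p := by
    rw [finslerUnit_eq hβ1 hN hβN hn]
    rfl
  have hW := inner_normal_deriv_finslerUnit hβ hβ1 hN hβN hn hDg u
  have hNN := inner_deriv_unitNormal_symm hDa hN hu hv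
  obtain ⟨X, hX, rfl, hNX⟩ := hN.exists_tangent_extension hu
  obtain ⟨Y, hY, rfl, hNY⟩ := hN.exists_tangent_extension hv
  have key := two_mul_inner_deriv_unitNormal hDa hDg
    (fun u v => by
      rw [inducedMetric_apply hβ1 hN hβN hn, inducedMetric_apply hβ1 hN hβN hn, a.symm p u]
      ring)
    (fun u v w => by
      simp only [inducedMetric_apply hβ1 hN hβN hn, map_sub, sub_apply]
      ring)
    (inducedMetric_finslerUnit hβ1 hN hβN hn p) hN hν hX hY hNX hNY
    (fun q => by rw [inducedMetric_finslerUnit hβ1 hN hβN hn, hNX, mul_zero])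
    (fun q => by rw [inducedMetric_finslerUnit hβ1 hN hβN hn, hNY, mul_zero])
  -- On leaf fields the terms of g containing N drop out; β is written as ⟨β♯, ·⟩ so that metric
  -- compatibility applies.
  have hgXY : (fun q => inducedMetric a β n q (X q) (Y q)) = fun q => (cFun a β q * cFun a β q) *
      (a.inner q (X q) (Y q) -
        a.inner q (sharpField a β q) (X q) * a.inner q (sharpField a β q) (Y q)) := by
    ext q
    rw [inducedMetric_apply hβ1 hN hβN hn, hNX, hNY, inner_sharpField, inner_sharpField]
    ring
  have hXY := mdifferentiableAt_inner a hX hY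
  have hbX := mdifferentiableAt_inner a hb hX
  have hbY := mdifferentiableAt_inner a hb hY
  have hdn : ∀ w, Da n p w = cFun a β p • Da N p w
      + mvfderiv (𝓡 (m + 1)) (cFun a β) p w • N p - Da (sharpField a β) p w := by
    intro w
    rw [hn.eq_smul_sub hβ1 hN hβN, Connection.sub Da (hcd.smul_section hNd) hb,
      Da.isCovariantDerivativeOnUniv.leibniz hNd hcd]
    rfl
  -- The derivative of c⁻² need not be computed: it multiplies n, which is g-orthogonal to X and Y.
  have hdν : ∀ w, Da (finslerUnit a β n) p w = (cFun a β p ^ 2)⁻¹ • Da n p w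
      + mvfderiv (𝓡 (m + 1)) (fun q => (cFun a β q ^ 2)⁻¹) p w • n p := by
    intro w
    rw [finslerUnit_eq hβ1 hN hβN hn, Da.isCovariantDerivativeOnUniv.leibniz hnd hφ]
    rfl
  have hbN : ∀ w, a.inner p (N p) (Da (sharpField a β) p w) = - β p (Da N p w) :=
    inner_normal_deriv_sharpField hβ hDa hN hβN
  have hNself := fun w => inner_deriv_unitNormal_self hDa hN (p := p) w
  have hdc := cFun_mul_mvfderiv_cFun hβ hβ1 hDa p
  -- D_w X need not be tangent, and g mixes its N-component with β; differentiating ⟨N, X⟩ = 0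
  -- expresses that component through D_w N.
  have hNx : ∀ w, a.inner p (N p) (Da X p w) = - a.inner p (X p) (Da N p w) := by
    intro w
    have e := hDa.mvfderiv_inner hNd hX w
    rw [funext hNX, mvfderiv_const, zero_apply, a.symm p (Da N p w)] at e
    linarith
  have hNy : ∀ w, a.inner p (N p) (Da Y p w) = - a.inner p (Y p) (Da N p w) := by
    intro w
    have e := hDa.mvfderiv_inner hNd hY w
    rw [funext hNY, mvfderiv_const, zero_apply, a.symm p (Da N p w)] at e
    linarith
  have hn_inner : ∀ w, a.inner p (n p) w = cFun a β p * a.inner p (N p) w - β p w := by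
    intro w
    rw [hn.eq_smul_sub hβ1 hN hβN]
    simp only [Pi.sub_apply, Pi.smul_apply', map_sub, map_smul, sub_apply, smul_apply,
      smul_eq_mul, inner_sharpField]
  have hβn : β p (n p) = cFun a β p ^ 2 - 1 := by
    rw [hn.eq_smul_sub hβ1 hN hβN, cFun_sq (hβ1 p)]
    simp only [Pi.sub_apply, Pi.smul_apply', map_sub, map_smul, smul_eq_mul, hβN, inner_sharpField]
    ring
  rw [hgXY, mvfderiv_sq_mul_sub hcd hXY hbX hbY, hDa.mvfderiv_inner hX hY,
    hDa.mvfderiv_inner hb hX, hDa.mvfderiv_inner hb hY] at key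
  have hNn : a.inner p (N p) (n p) = cFun a β p := by
    rw [a.symm, hn_inner, hN.unit, hβN]
    ring
  have hXn : a.inner p (X p) (n p) = - β p (X p) := by
    rw [a.symm, hn_inner, hNX]
    ring
  have hYb : a.inner p (Y p) (sharpField a β p) = β p (Y p) := by rw [a.symm, inner_sharpField]
  have hdc' : ∀ w, β p (Da (sharpField a β) p w) =
      - (cFun a β p * mvfderiv (𝓡 (m + 1)) (cFun a β) p w) := fun w => by rw [hdc, neg_neg]
  have hNN' : a.inner p (X p) (Da N p (Y p)) = a.inner p (Y p) (Da N p (X p)) := by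
    rw [a.symm p (X p), ← hNN, a.symm]
  simp only [inducedMetric_apply hβ1 hN hβN hn, hνp, hdν, hdn, map_add, map_sub, map_smul,
    add_apply, sub_apply, smul_apply, smul_eq_mul, hNX, hNY, hNself, hbN, hNx, hNy, hn_inner, hβn,
    hN.unit, hβN, inner_sharpField, hW, a.symm p _ (Y p), a.symm p (Da (sharpField a β) p (n p)),
    a.symm p _ (N p), hNn, hXn, hYb, mul_zero, zero_mul, add_zero,
    zero_add, mul_one, hdc', hNN'] at key
  rw [a.symm p (X p) (Y p)]
  have key' := congrArg (cFun a β p ^ 2 * ·) key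
  field_simp at key'
  linear_combination cFun a β p * key'

/-! ### Solving for the shape operator. -/

theorem IsUnitNormal.ext_of_inner (hN : IsUnitNormal a ℱ N) {x y : TangentSpace (𝓡 (m + 1)) p}
    (h1 : a.inner p (N p) x = a.inner p (N p) y)
    (h2 : ∀ v, a.inner p (N p) v = 0 → a.inner p v x = a.inner p v y) : x = y := by
  refine inner_ext (a := a) fun w => ?_
  have h := h2 (w - a.inner p (N p) w • N p) (by simp [hN.unit p])
  simp only [map_sub, map_smul, sub_apply, smul_apply, smul_eq_mul, h1] at h
  rw [a.symm p x, a.symm p y]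
  linarith

theorem inner_tang {v : TangentSpace (𝓡 (m + 1)) p} (hv : a.inner p (N p) v = 0)
    (x : TangentSpace (𝓡 (m + 1)) p) : a.inner p v (tang a N p x) = a.inner p v x := by
  rw [tang, map_sub, map_smul, a.symm p v (N p), hv, smul_zero, sub_zero]

theorem inner_normal_tang (hN : IsUnitNormal a ℱ N) (x : TangentSpace (𝓡 (m + 1)) p) :
    a.inner p (N p) (tang a N p x) = 0 := by
  rw [tang, map_sub, map_smul, hN.unit, a.symm p x, smul_eq_mul, mul_one, sub_self]

theorem inner_deform (D : Connection m M) (ξ : VField m M) (u v : TangentSpace (𝓡 (m + 1)) p) :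
    a.inner p v (deform a D ξ p u) =
      (1 / 2) * (a.inner p v (D ξ p u) + a.inner p u (D ξ p v)) := by
  have : a.inner p v (conjDeriv a D ξ p u) = a.inner p u (D ξ p v) := by
    rw [a.symm, conjDeriv, inner_sharp]
    rfl
  rw [deform, map_smul, map_add, this, smul_eq_mul]

/-- Solving for the shape operator: `g` restricted to the leaf is `c² (a - β ⊗ β)`, which is
inverted by pairing with `v` and with `β♯`. -/
theorem shape_formula_aux {c wv wb dN db du uv βu βv nvu bvu buv vz vnb vbn vbb uz unb ubn ubb bz
    k : ℝ} (hc : c ≠ 0)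
    (F1 : 2 * c ^ 4 * (wv - wb * βv) = 2 * c * (c * dN - db) * (uv - βu * βv) + 2 * c ^ 3 * nvu
      - c ^ 2 * (bvu + buv) + βu * (c ^ 3 * (c * vz - vnb) - c ^ 2 * (c * vbn - vbb))
      + βv * (c ^ 3 * (c * uz - unb) - c ^ 2 * (c * ubn - ubb)))
    (F2 : 2 * c ^ 4 * (wb - wb * (1 - c ^ 2)) = 2 * c * (c * dN - db) * (βu - βu * (1 - c ^ 2))
      + 2 * c ^ 3 * unb - c ^ 2 * (-(c * du) + ubb)
      + βu * (c ^ 3 * (c * bz - k * (1 - c ^ 2)) - c ^ 2 * (c * -(c * dN) - -(c * db)))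
      + (1 - c ^ 2) * (c ^ 3 * (c * uz - unb) - c ^ 2 * (c * ubn - ubb))) :
    c * -wv = -nvu - (c ^ 2)⁻¹ * (c * dN - db) * uv + c⁻¹ * (1 / 2 * (bvu + buv))
      + -(1 / 2) * (c ^ 2)⁻¹ * ((c * dN - db) * βu - 2 * c⁻¹ * (1 / 2 * (ubb + -(c * du)))
          - (ubn - c⁻¹ * ubb) + c * uz + c * bz * βu - (-unb - -k * βu)) * βv
      + βu * (1 / 2 * (vbn - c⁻¹ * vbb - c * vz - (-vnb - -k * βv))) := by
  -- Here wv = ⟨v, W⟩ and wb = β(W) for W = ∇_u ν, and `F2` is `F1` at v = β♯. In c² F1 + β(v) F2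
  -- the unknown wb cancels and the left side is 2 c⁶ wv.
  field_simp
  refine mul_left_cancel₀ (pow_ne_zero 2 hc) ?_
  linear_combination -c ^ 2 * F1 - βv * F2

/-- The relation between the shape operators of a leaf for `g` and for `a`. -/
theorem cFun_smul_shape_finslerUnit (hβ : SmoothForm β) (hβ1 : ∀ p, formNorm a β p < 1)
    (hN : IsUnitNormal a ℱ N) (hβN : ∀ p, β p (N p) = 0) (hn : IsFinslerNormal a β ℱ N n)
    {Da : Connection m M} (hDa : IsLeviCivita (fun p u v => a.inner p u v) Da)
    {Dg : Connection m M} (hDg : IsLeviCivita (inducedMetric a β n) Dg)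
    {u : TangentSpace (𝓡 (m + 1)) p} (hu : u ∈ ℱ.tangent p) :
    cFun a β p • shape Dg (finslerUnit a β n) p u =
        shape Da N p u - ((cFun a β p ^ 2)⁻¹ * derivC a β N p) • u
        + (cFun a β p)⁻¹ • tang a N p (deform a Da (sharpField a β) p u)
        + a.inner p (U₁ a Da β N p) u • sharpField a β p
        + β p u • U₂ a Da β N p := by
  rw [hN.mem_tangent_iff] at hu
  have hc := (cFun_pos (hβ1 p)).ne'
  have hbb : β p (sharpField a β p) = 1 - cFun a β p ^ 2 := by
    rw [cFun_sq (hβ1 p), inner_sharpField]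
    ring
  have hNb : a.inner p (N p) (sharpField a β p) = 0 := by rw [a.symm, inner_sharpField, hβN]
  have hNself := fun w => inner_deriv_unitNormal_self hDa hN (p := p) w
  have hW := inner_normal_deriv_finslerUnit hβ hβ1 hN hβN hn hDg u
  refine hN.ext_of_inner ?_ fun v hv => ?_
  · simp only [shape, U₂, curvVec, transDeriv, perpForm, map_add, map_sub, map_smul, map_neg, hW,
      hNself, inner_normal_tang hN, hNb, hu]
    simp
  have hvb : ∀ w, a.inner p w (sharpField a β p) = β p w := fun w => by
    rw [a.symm, inner_sharpField]
  have F1 := second_fundamental_form hβ hβ1 hN hβN hn hDa hDg hu hv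
  -- β♯ is an admissible test vector, being tangent to the leaf.
  have F2 := second_fundamental_form hβ hβ1 hN hβN hn hDa hDg hu hNb
  have hnp : n p = cFun a β p • N p - sharpField a β p := congrFun (hn.eq_smul_sub hβ1 hN hβN) p
  have hdc' : ∀ w, β p (Da (sharpField a β) p w) =
      - (cFun a β p * mvfderiv (𝓡 (m + 1)) (cFun a β) p w) := fun w => by
    rw [cFun_mul_mvfderiv_cFun hβ hβ1 hDa p, neg_neg]
  have hsymm : β p (Da N p u) = a.inner p u (Da N p (sharpField a β p)) := by
    rw [← inner_sharpField a β p (Da N p u), a.symm, inner_deriv_unitNormal_symm hDa hN hu hNb,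
      a.symm]
  -- k is β(D_{β♯} N) / ‖β‖², the coefficient in `perpForm`. Where β♯ = 0 the convention 0⁻¹ = 0
  -- gives k = 0 and both sides of the second equation vanish, so the algebra needs no case split.
  obtain ⟨k, hk, hk'⟩ : ∃ k, - β p (Da N p (sharpField a β p)) * (1 - cFun a β p ^ 2)⁻¹ = - k ∧
      β p (Da N p (sharpField a β p)) = k * (1 - cFun a β p ^ 2) := by
    refine ⟨β p (Da N p (sharpField a β p)) * (1 - cFun a β p ^ 2)⁻¹, by ring, ?_⟩
    by_cases hb0 : sharpField a β p = 0
    · rw [hb0, map_zero, map_zero, zero_mul, zero_mul]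
    · have : (1 - cFun a β p ^ 2) ≠ 0 := by
        rw [← hbb, ← inner_sharpField]
        exact (a.pos p _ hb0).ne'
      field_simp
  have hf : formNorm a β p ^ 2 = 1 - cFun a β p ^ 2 := by rw [formNorm_sq, inner_sharpField, hbb]
  rw [hnp] at F1 F2
  simp only [map_sub, map_smul, smul_eq_mul, inner_sharpField, hbb, hvb, hdc', hsymm,
    hk'] at F1 F2
  rw [a.symm p (U₁ a Da β N p)]
  simp only [shape, U₁, U₂, curvVec, derivC, transDeriv, perpForm, map_add, map_sub, map_smul,
    map_neg, neg_apply, inner_tang hu, inner_tang hv, inner_deform, hvb, smul_eq_mul,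
    inner_sharpField, hdc', hf, hk]
  rw [a.symm p u v] at F1
  exact shape_formula_aux hc F1 F2

/-! ### Constant norm and parallel form. -/

theorem derivC_eq_zero_of_formNorm_const {k : ℝ} (h : ∀ p, formNorm a β p = k) :
    derivC a β N p = 0 := by
  have : cFun a β = fun _ => Real.sqrt (1 - k ^ 2) := by
    ext q
    rw [cFun, h]
  rw [derivC, this, mvfderiv_const, zero_apply]

theorem U₁_of_derivC_eq_zero {D : Connection m M} (h : derivC a β N p = 0) :
    U₁ a D β N p = (1 / 2 * (cFun a β p ^ 2)⁻¹ : ℝ) •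
      ((2 * (cFun a β p)⁻¹) • tang a N p (deform a D (sharpField a β) p (sharpField a β p))
        + transDeriv a D β N p
        + perpForm a β p (shape D N p (sharpField a β p))
        - cFun a β p • curvVec D N p
        - (cFun a β p * a.inner p (curvVec D N p) (sharpField a β p)) • sharpField a β p) := by
  rw [U₁, h, a.symm p (curvVec D N p), inner_sharpField]
  module

/-- Metric compatibility gives ⟨D_v β♯, w⟩ = (D_v β)(w). -/
theorem deriv_sharpField_of_isParallelForm {D : Connection m M} (hβ : SmoothForm β)
    (hD : IsLeviCivita (fun p u v => a.inner p u v) D) (h : IsParallelForm D β) (p : M) :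
    D (sharpField a β) p = 0 := by
  ext1 v
  refine inner_ext (a := a) fun w => ?_
  have hY : DiffFieldAt (FiberBundle.extend (Model m) w) p :=
    FiberBundle.mdifferentiableAt_extend (𝓡 (m + 1)) (Model m) w
  have e := hD.mvfderiv_inner (mdifferentiableAt_sharpField a hβ p) hY v
  have e' := h _ p hY v
  simp only [inner_sharpField, FiberBundle.extend_apply_self] at e
  rw [zero_apply, map_zero, zero_apply]
  linarith

theorem deform_eq_zero {D : Connection m M} {ξ : VField m M} (h : D ξ p = 0)
    (u : TangentSpace (𝓡 (m + 1)) p) : deform a D ξ p u = 0 := by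
  refine inner_ext (a := a) fun w => ?_
  rw [a.symm, inner_deform, h]
  simp

theorem transDeriv_eq_zero {D : Connection m M} (h : D (sharpField a β) p = 0) :
    transDeriv a D β N p = 0 := by
  simp [transDeriv, h, tang]

/-- M is not assumed connected, so a parallel β need not have globally constant norm; the vanishing
is read off pointwise from c dc = -β(D β♯). -/
theorem derivC_eq_zero {D : Connection m M} (hβ : SmoothForm β)
    (hβ1 : ∀ p, formNorm a β p < 1) (hD : IsLeviCivita (fun p u v => a.inner p u v) D)
    (h : D (sharpField a β) p = 0) : derivC a β N p = 0 := by
  have := cFun_mul_mvfderiv_cFun hβ hβ1 hD p (cFun a β p • N p - sharpField a β p)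
  rw [h, zero_apply, map_zero, neg_zero] at this
  exact (mul_eq_zero.1 this).resolve_left (cFun_pos (hβ1 p)).ne'

end RandersFoliation

/-! ### The general formula and its two special cases. -/

theorem proposition3 (m : ℕ) {M : Type*} [TopologicalSpace M] [T2Space M] [SigmaCompactSpace M]
    [ChartedSpace (Model m) M] [IsManifold (𝓡 (m + 1)) ∞ M]
    (a : RandersFoliation.Metric m M)
    (β : OneForm m M) (hβ : SmoothForm β) (hβ1 : ∀ p, formNorm a β p < 1)
    (ℱ : CodimOneFoliation m M)
    (N : VField m M) (hN : IsUnitNormal a ℱ N) (hβN : ∀ p, β p (N p) = 0)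
    (n : VField m M) (hn : IsFinslerNormal a β ℱ N n)
    (Da : Connection m M) (hDa : IsLeviCivita (fun p u v => a.inner p u v) Da)
    (Dg : Connection m M) (hDg : IsLeviCivita (inducedMetric a β n) Dg) :
    -- the general formula
    (∀ p, ∀ u ∈ ℱ.tangent p,
      cFun a β p • shape Dg (finslerUnit a β n) p u =
        shape Da N p u
        - ((cFun a β p ^ 2)⁻¹ *
            mvfderiv (𝓡 (m + 1)) (cFun a β) p (cFun a β p • N p - sharpField a β p)) • u
        + (cFun a β p)⁻¹ • tang a N p (deform a Da (sharpField a β) p u)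
        + a.inner p (U₁ a Da β N p) u • sharpField a β p
        + β p u • U₂ a Da β N p) ∧
    -- the case of constant `‖β‖_α`
    ((∃ k : ℝ, ∀ p, formNorm a β p = k) →
      ∀ p, ∀ u ∈ ℱ.tangent p,
        cFun a β p • shape Dg (finslerUnit a β n) p u =
          shape Da N p u
          + (cFun a β p)⁻¹ • tang a N p (deform a Da (sharpField a β) p u)
          + β p u • ((1 / 2 : ℝ) •
              (tang a N p (Da (sharpField a β) p (N p - (cFun a β p)⁻¹ • sharpField a β p))
                - cFun a β p • curvVec Da N p
                - perpForm a β p (shape Da N p (sharpField a β p))))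
          + a.inner p ((1 / 2 * (cFun a β p ^ 2)⁻¹ : ℝ) •
              ((2 * (cFun a β p)⁻¹) •
                  tang a N p (deform a Da (sharpField a β) p (sharpField a β p))
                + tang a N p (Da (sharpField a β) p (N p - (cFun a β p)⁻¹ • sharpField a β p))
                + perpForm a β p (shape Da N p (sharpField a β p))
                - cFun a β p • curvVec Da N p
                - (cFun a β p * a.inner p (curvVec Da N p) (sharpField a β p)) •
                    sharpField a β p)) u • sharpField a β p) ∧
    -- the case of parallel `β`
    (IsParallelForm Da β →
      ∀ p, ∀ u ∈ ℱ.tangent p,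
        cFun a β p • shape Dg (finslerUnit a β n) p u =
          shape Da N p u
          - β p u • ((1 / 2 : ℝ) •
              (perpForm a β p (shape Da N p (sharpField a β p))
                + cFun a β p • curvVec Da N p))
          + a.inner p ((1 / 2 * (cFun a β p ^ 2)⁻¹ : ℝ) •
              (perpForm a β p (shape Da N p (sharpField a β p))
                - cFun a β p • curvVec Da N p
                - (cFun a β p * a.inner p (curvVec Da N p) (sharpField a β p)) •
                    sharpField a β p)) u • sharpField a β p) := by
  have general := fun p (u : TangentSpace (𝓡 (m + 1)) p) (hu : u ∈ ℱ.tangent p) =>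
    cFun_smul_shape_finslerUnit hβ hβ1 hN hβN hn hDa hDg hu
  refine ⟨general, ?_, ?_⟩
  · rintro ⟨k, hk⟩ p u hu
    have h0 : derivC a β N p = 0 := derivC_eq_zero_of_formNorm_const hk
    rw [general p u hu, U₁_of_derivC_eq_zero h0, h0, mul_zero, zero_smul, sub_zero]
    unfold U₂ transDeriv
    abel
  · intro hpar p u hu
    have hb := deriv_sharpField_of_isParallelForm hβ hDa hpar p
    have h0 : derivC a β N p = 0 := derivC_eq_zero hβ hβ1 hDa hb
    have ht : tang a N p 0 = 0 := by simp [tang]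
    rw [general p u hu, U₁_of_derivC_eq_zero h0, h0, U₂, transDeriv_eq_zero hb,
      deform_eq_zero hb, deform_eq_zero hb, ht, mul_zero, zero_smul, sub_zero, smul_zero, smul_zero,
      add_zero, add_zero, zero_add, zero_sub]
    module
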